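/- Let $F:\mathbb R^n\times\mathbb R^m\to\mathbb R^n$, let $\rho:\mathbb R^n\to\mathbb R^m$ be a feedback control, write $F(x):=F(x,\rho(x))$, and let $x^*$ be a point of $\mathcal X:=\{x\in\mathbb R^n: F(x)=0\}$. Let $(x_k)_{k\ge 0}$ and $(w_k)_{k\ge0}$ be random vectors in $\mathbb R^n$ on a probability space such that, almost surely, $$x_{k+1}=x_k+\alpha_k\,(F(x_k,\rho(x_k))+w_k),\qquad \alpha_k=\frac{\alpha}{(k+K)^{\xi}}\qquad(k\ge 0),$$ with constants $\alpha,K>0$. For a locally Lipschitz function $V:\mathbb R^n\to\mathbb R$ let $\partial V(x)$ denote its Clarke generalized gradient, i.e. the closed convex hull of all limits $\lim_i\nabla V(y_i)$ with $y_i\to x$ and $V$ differentiable at each $y_i$. Assume that there is a radius $r\ge\|x^*\|$ such that the following hold, where $\|\cdot\|$ is the Euclidean norm and $\mathcal B=\{x:\|x\|\le r\}$. 1. (Noise) With $\mathcal F_k=\sigma(x_0,w_0,\dots,x_{k-1},w_{k-1},x_k)$, for every $k\ge0$ the vector $w_k$ is square-integrable, $\mathbb E[w_k\mid\mathcal F_k]=0$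 and $\mathbb E[\|w_k\|^2\mid\mathcal F_k]\le A+B\|x_k\|^2$ almost surely, for constants $A,B$. 2. (Bounded iterates) $\|x_k\|\le r$ almost surely, for every $k\ge0$. 3. (Lipschitz closed loop) $\|F(x)-F(y)\|\le C\|x-y\|$ for all $x,y\in\mathcal B$, for a constant $C$. 4. (Lyapunov function) $V$ is locally Lipschitz and, for constants $a>0$, $c\ge1$, $C_1,C_2,\gamma>0$ and $G$, for all $x\in\mathcal B$ and all $g\in\partial V(x)$, $$C_1\|x-x^*\|^a\le V(x)\le C_2\|x-x^*\|^a,\qquad \|g\|\le G\|x-x^*\|^{a-1},\qquad \langle g,F(x)\rangle\le-\gamma V(x)^c .$$ Put $d_{a,c}=\frac{a(c-1)}2+1$ and $d=\frac{3d_{a,c}}{3d_{a,c}-1}$. If $\xi\in\left(\frac23,\frac{2d}3\right]$, then almost surely $\lim_{k\to\infty}\operatorname{dist}(x_k,\mathcal X)=0$, and moreover $\lim_{k\to\infty}x_k=x^*$. -/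

import Mathlib

open MeasureTheory Filter Topology

/-- The Clarke generalized gradient of a (locally Lipschitz) function `V` at `x`: the closed convex
hull of all limits of gradients `∇ V (y i)` along sequences `y i → x` of points at which `V` is
differentiable. -/
noncomputable def clarkeGradient {n : ℕ} (V : EuclideanSpace ℝ (Fin n) → ℝ)
    (x : EuclideanSpace ℝ (Fin n)) : Set (EuclideanSpace ℝ (Fin n)) :=
  closure (convexHull ℝ {g | ∃ y : ℕ → EuclideanSpace ℝ (Fin n),
    (∀ i, DifferentiableAt ℝ V (y i)) ∧ Tendsto y atTop (𝓝 x) ∧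
      Tendsto (fun i => gradient V (y i)) atTop (𝓝 g)})

/-- The σ-algebra generated by `x 0, w 0, …, x (k-1), w (k-1), x k`. -/
@[reducible]
def history {Ω E : Type*} [MeasurableSpace E] (x w : ℕ → Ω → E) (k : ℕ) : MeasurableSpace Ω :=
  (⨆ (j : ℕ) (_ : j ≤ k), MeasurableSpace.comap (x j) inferInstance) ⊔
    (⨆ (j : ℕ) (_ : j < k), MeasurableSpace.comap (w j) inferInstance)

/-- The noise assumptions: each `w k` is a square-integrable random vector, is conditionally
unbiased given the history up to time `k`, and has conditional second moment at most
`A + B * ‖x k‖ ^ 2`. -/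
structure NoiseAssumption {Ω : Type*} [MeasurableSpace Ω] (P : Measure Ω) {n : ℕ}
    (x w : ℕ → Ω → EuclideanSpace ℝ (Fin n)) (A B : ℝ) : Prop where
  measurable : ∀ k, Measurable (w k)
  memLp : ∀ k, MemLp (w k) 2 P
  unbiased : ∀ k, P[w k | history x w k] =ᵐ[P] 0
  second_moment : ∀ k,
    P[fun ω => ‖w k ω‖ ^ 2 | history x w k] ≤ᵐ[P] fun ω => A + B * ‖x k ω‖ ^ 2

/-- The nonsmooth sub-exponential Lyapunov assumptions on a set `S` for the closed-loop vector
field `f`, with equilibrium `xs`: polynomial growth of order `a`, the matching growth bound for the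
Clarke gradient, and sub-exponential stability with exponent `c`. -/
structure LyapunovAssumption {n : ℕ} (V : EuclideanSpace ℝ (Fin n) → ℝ)
    (f : EuclideanSpace ℝ (Fin n) → EuclideanSpace ℝ (Fin n)) (xs : EuclideanSpace ℝ (Fin n))
    (S : Set (EuclideanSpace ℝ (Fin n))) (a c C₁ C₂ G γ : ℝ) : Prop where
  locallyLipschitz : LocallyLipschitz V
  lower_growth : ∀ x ∈ S, C₁ * ‖x - xs‖ ^ a ≤ V x
  upper_growth : ∀ x ∈ S, V x ≤ C₂ * ‖x - xs‖ ^ a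
  gradient_growth : ∀ x ∈ S, ∀ g ∈ clarkeGradient V x, ‖g‖ ≤ G * ‖x - xs‖ ^ (a - 1)
  drift : ∀ x ∈ S, ∀ g ∈ clarkeGradient V x, inner ℝ g (f x) ≤ -γ * V x ^ c

/-- The exponent `d_{a,c} = a (c - 1) / 2 + 1`. -/
noncomputable def driftExponent (a c : ℝ) : ℝ := a * (c - 1) / 2 + 1

/-- The exponent `d = 3 d_{a,c} / (3 d_{a,c} - 1)`. -/
noncomputable def rateExponent (a c : ℝ) : ℝ :=
  3 * driftExponent a c / (3 * driftExponent a c - 1)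

/-! The noise is removed first. Since `ξ > 1/2`, the steps are square summable, so the weighted
noise series is an L²-bounded martingale and converges almost surely
(`NoiseAssumption.ae_exists_tendsto_sum`). Adding its tail to `x k` gives `y k` with `y k - x k → 0`
and `y (k + 1) = y k + s k • f (x k)`: an Euler scheme whose field is evaluated at a slightly wrong
point.

The rest is deterministic (`tendsto_of_strict_clarke_lyapunov`). Away from `xs`, compactness makes
the Clarke descent uniform over nearby gradients (`exists_forall_inner_gradient_le`), and a mean
value inequality (`LocallyLipschitz.le_add_of_fderiv_le`) turns it into a decrease of `V (y k)` by
at least `η * s k`. As `ξ ≤ 1`, the steps have infinite sum, so `V (y k)` drops below every level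
above `V xs` and stays there; `xs` is the strict minimum of `V` on the ball, hence the only limit
point. -/

/-! ### Mean value inequality for locally Lipschitz functions. -/

section MeanValue

variable {E : Type*} [NormedAddCommGroup E] [NormedSpace ℝ E] [FiniteDimensional ℝ E]

/-- Rademacher's theorem for locally Lipschitz functions. -/
theorem LocallyLipschitz.ae_differentiableAt' [MeasurableSpace E] [BorelSpace E] (μ : Measure E)
    [μ.IsAddHaarMeasure] {V : E → ℝ} (hV : LocallyLipschitz V) :
    ∀ᵐ x ∂μ, DifferentiableAt ℝ V x := by
  refine measure_null_of_locally_null _ fun x _ => ?_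
  obtain ⟨K, t, ht, hK⟩ := hV x
  obtain ⟨u, hut, huo, hxu⟩ := mem_nhds_iff.1 ht
  refine ⟨{x | ¬ DifferentiableAt ℝ V x} ∩ u,
    inter_mem_nhdsWithin _ (huo.mem_nhds hxu), ?_⟩
  have h := (hK.mono hut).ae_differentiableWithinAt_of_mem (μ := μ)
  refine measure_mono_null ?_ h
  rintro z ⟨hz, hzu⟩ hd
  exact hz ((hd hzu).differentiableAt (huo.mem_nhds hzu))

theorem LocallyLipschitz.exists_lipschitzOnWith_closedBall {V : E → ℝ} (hV : LocallyLipschitz V)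
    (y : E) (R : ℝ) : ∃ K, LipschitzOnWith K V (Metric.closedBall y R) :=
  (hV.locallyLipschitzOn).exists_lipschitzOnWith_of_compact (isCompact_closedBall y R)

/-- The integral of a locally Lipschitz function over a translated ball is differentiable in the
translation parameter. -/
theorem LocallyLipschitz.hasDerivAt_setIntegral_ball [MeasurableSpace E] [BorelSpace E]
    (μ : Measure E) [μ.IsAddHaarMeasure] {V : E → ℝ} (hV : LocallyLipschitz V) (y v : E) (δ t : ℝ) :
    IntegrableOn (fun z => fderiv ℝ V (z + t • v) v) (Metric.ball y δ) μ ∧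
      HasDerivAt (fun s : ℝ => ∫ z in Metric.ball y δ, V (z + s • v) ∂μ)
        (∫ z in Metric.ball y δ, fderiv ℝ V (z + t • v) v ∂μ) t := by
  have hVc := hV.continuous
  obtain ⟨K, hK⟩ := hV.exists_lipschitzOnWith_closedBall y (δ + (|t| + 1) * ‖v‖)
  have hfin : IsFiniteMeasure (μ.restrict (Metric.ball y δ)) :=
    ⟨by simpa using measure_ball_lt_top⟩
  have hmem : ∀ z ∈ Metric.ball y δ, ∀ s ∈ Metric.ball t 1,
      z + s • v ∈ Metric.closedBall y (δ + (|t| + 1) * ‖v‖) := by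
    intro z hz s hs
    rw [Metric.mem_ball, dist_eq_norm] at hz
    rw [Metric.mem_ball, Real.dist_eq] at hs
    have h1 : |s| ≤ |t| + 1 := by
      have := abs_sub_abs_le_abs_sub s t
      linarith
    rw [Metric.mem_closedBall, dist_eq_norm]
    calc ‖z + s • v - y‖ = ‖(z - y) + s • v‖ := by congr 1; abel
      _ ≤ ‖z - y‖ + |s| * ‖v‖ := by
        simpa [norm_smul] using norm_add_le (z - y) (s • v)
      _ ≤ _ := by gcongr
  refine (hasDerivAt_integral_of_dominated_loc_of_lip (bound := fun _ => (K : ℝ) * ‖v‖)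
    (s := Metric.ball t 1) (Metric.ball_mem_nhds t one_pos) ?_ ?_ ?_ ?_ ?_ ?_)
  · exact Eventually.of_forall fun s =>
      (hVc.comp (continuous_id.add continuous_const)).aestronglyMeasurable
  · exact ((hVc.comp (continuous_id.add continuous_const)).continuousOn.integrableOn_compact
      (isCompact_closedBall y δ)).mono_set Metric.ball_subset_closedBall
  · exact ((measurable_fderiv_apply_const ℝ V v).comp
      (measurable_id.add_const _)).aestronglyMeasurable
  · filter_upwards [ae_restrict_mem measurableSet_ball] with z hz
    refine LipschitzOnWith.of_dist_le_mul fun s hs s' hs' => ?_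
    refine (hK.dist_le_mul _ (hmem z hz s hs) _ (hmem z hz s' hs')).trans (le_of_eq ?_)
    rw [dist_add_left, dist_eq_norm, ← sub_smul, norm_smul, Real.dist_eq, Real.coe_nnabs,
      abs_of_nonneg (by positivity), Real.norm_eq_abs]
    ring
  · exact integrable_const _
  · refine ae_restrict_of_ae ?_
    have h := (measurePreserving_add_right μ (t • v)).quasiMeasurePreserving.ae
      (hV.ae_differentiableAt' μ)
    filter_upwards [h] with z hz
    have h1 : HasDerivAt (fun s : ℝ => z + s • v) v t := by
      simpa using ((hasDerivAt_id t).smul_const v).const_add z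
    exact hz.hasFDerivAt.comp_hasDerivAt t h1

/-- A mean value inequality for locally Lipschitz functions: it is enough to control the derivative
at the points of differentiability near the segment. -/
theorem LocallyLipschitz.le_add_of_fderiv_le {V : E → ℝ} (hV : LocallyLipschitz V) {p y v : E}
    {ε m : ℝ} (hy : y ∈ Metric.ball p ε) (hyv : y + v ∈ Metric.ball p ε)
    (hm : ∀ z ∈ Metric.ball p ε, DifferentiableAt ℝ V z → fderiv ℝ V z v ≤ m) :
    V (y + v) ≤ V y + m := by
  let _ : MeasurableSpace E := borel E
  have _ : BorelSpace E := ⟨rfl⟩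
  let μ : Measure E := Measure.addHaar
  have hVc := hV.continuous
  by_contra! hlt
  obtain ⟨m', hm1, hm2⟩ : ∃ m', m < m' ∧ m' < V (y + v) - V y := exists_between (by linarith)
  -- `V` may fail to be differentiable along the whole segment. The strict inequality survives on a
  -- ball of parallel segments, and after averaging over that ball a null set of bad points no
  -- longer matters.
  have hev : ∀ᶠ z in 𝓝 y, (z ∈ Metric.ball p ε ∧ z + v ∈ Metric.ball p ε) ∧
      m' < V (z + v) - V z := by
    have hyb : ∀ᶠ z in 𝓝 y, z ∈ Metric.ball p ε := Metric.isOpen_ball.mem_nhds hy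
    refine (hyb.and ?_).and ?_
    · exact (continuous_add_const v).continuousAt.eventually (Metric.isOpen_ball.mem_nhds hyv)
    · have hc : Continuous fun z => V (z + v) - V z := by fun_prop
      exact hc.continuousAt.eventually (lt_mem_nhds hm2)
  obtain ⟨δ, hδ, hball⟩ := Metric.eventually_nhds_iff_ball.1 hev
  have hvol : 0 < μ.real (Metric.ball y δ) :=
    ENNReal.toReal_pos (Metric.measure_ball_pos μ y hδ).ne' measure_ball_lt_top.ne
  have hderiv := fun t => (hV.hasDerivAt_setIntegral_ball μ y v δ t).2
  have hcst : ∀ a : ℝ, IntegrableOn (fun _ : E => a) (Metric.ball y δ) μ := fun a =>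
    integrableOn_const measure_ball_lt_top.ne
  have hint : ∀ s : ℝ, IntegrableOn (fun z => V (z + s • v)) (Metric.ball y δ) μ := fun s =>
    ((hVc.comp (continuous_id.add continuous_const)).continuousOn.integrableOn_compact
      (isCompact_closedBall y δ)).mono_set Metric.ball_subset_closedBall
  have hupper := (convex_Icc (0 : ℝ) 1).image_sub_le_mul_sub_of_deriv_le
    (f := fun s : ℝ => ∫ z in Metric.ball y δ, V (z + s • v) ∂μ)
    (C := μ.real (Metric.ball y δ) * m)
    (fun s _ => (hderiv s).continuousAt.continuousWithinAt)
    (fun s _ => (hderiv s).differentiableAt.differentiableWithinAt) ?_ 0 (by simp) 1 (by simp)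
    zero_le_one
  · have hlower : μ.real (Metric.ball y δ) * m' ≤
        ∫ z in Metric.ball y δ, (V (z + (1 : ℝ) • v) - V (z + (0 : ℝ) • v)) ∂μ := by
      rw [← smul_eq_mul, ← setIntegral_const]
      refine setIntegral_mono_on (hcst m') ((hint 1).sub (hint 0)) measurableSet_ball
        fun z hz => ?_
      simpa using (hball z hz).2.le
    rw [integral_sub (hint 1) (hint 0)] at hlower
    have : μ.real (Metric.ball y δ) * m' ≤ μ.real (Metric.ball y δ) * m := by
      simpa using hlower.trans hupper
    exact absurd (le_of_mul_le_mul_left this hvol) (not_le.2 hm1)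
  · intro s hs
    rw [interior_Icc] at hs
    rw [(hderiv s).deriv, ← smul_eq_mul, ← setIntegral_const]
    refine setIntegral_mono_on_ae (hV.hasDerivAt_setIntegral_ball μ y v δ s).1 (hcst m)
      measurableSet_ball ?_
    have h := (measurePreserving_add_right μ (s • v)).quasiMeasurePreserving.ae
      (hV.ae_differentiableAt' μ)
    filter_upwards [h] with z hz hzb
    refine hm _ ?_ hz
    have hb := (hball z hzb).1
    have := (convex_ball p ε) hb.1 hb.2 (sub_nonneg.2 hs.2.le) hs.1.le (by ring)
    convert this using 1
    module

end MeanValue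

/-! ### Uniform descent from the Clarke gradient. -/

section Clarke

variable {n : ℕ} {V : EuclideanSpace ℝ (Fin n) → ℝ}

theorem mem_clarkeGradient_of_tendsto {x g : EuclideanSpace ℝ (Fin n)}
    {y : ℕ → EuclideanSpace ℝ (Fin n)} (hd : ∀ i, DifferentiableAt ℝ V (y i))
    (hy : Tendsto y atTop (𝓝 x)) (hg : Tendsto (fun i => gradient V (y i)) atTop (𝓝 g)) :
    g ∈ clarkeGradient V x :=
  subset_closure (subset_convexHull ℝ _ ⟨y, hd, hy, hg⟩)

/-- If every Clarke gradient makes a negative inner product with a continuous vector field on a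
compact set, then so do, uniformly, the gradients at all nearby points. -/
theorem exists_forall_inner_gradient_le (hV : LocallyLipschitz V)
    {S : Set (EuclideanSpace ℝ (Fin n))} (hS : IsCompact S)
    {f : EuclideanSpace ℝ (Fin n) → EuclideanSpace ℝ (Fin n)} (hf : ContinuousOn f S)
    (hneg : ∀ x ∈ S, ∀ g ∈ clarkeGradient V x, inner ℝ g (f x) < 0) :
    ∃ η > 0, ∃ ε > 0, ∀ x ∈ S, ∀ y, dist y x < ε → DifferentiableAt ℝ V y →
      inner ℝ (gradient V y) (f x) ≤ -η := by
  by_contra! hcon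
  choose! x hxS y hyx hdiff hinner using fun k : ℕ =>
    hcon (1 / ((k : ℝ) + 1)) Nat.one_div_pos_of_nat (1 / ((k : ℝ) + 1)) Nat.one_div_pos_of_nat
  obtain ⟨x₀, hx₀, φ, hφ, hlim⟩ := hS.tendsto_subseq hxS
  have hsmall : Tendsto (fun k => 1 / ((φ k : ℝ) + 1)) atTop (𝓝 0) :=
    (tendsto_one_div_add_atTop_nhds_zero_nat (𝕜 := ℝ)).comp hφ.tendsto_atTop
  have hylim : Tendsto (y ∘ φ) atTop (𝓝 x₀) := by
    refine (tendsto_iff_of_dist ?_).2 hlim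
    exact squeeze_zero (fun _ => dist_nonneg) (fun k => (hyx (φ k)).le) hsmall
  obtain ⟨K, t, ht, hK⟩ := hV x₀
  have hbound : ∀ᶠ k in atTop, gradient V (y (φ k)) ∈ Metric.closedBall 0 (K : ℝ) := by
    filter_upwards [hylim.eventually (eventually_mem_nhds_iff.2 ht)] with k hk
    rw [mem_closedBall_zero_iff, gradient, LinearIsometryEquiv.norm_map]
    exact norm_fderiv_le_of_lipschitzOn ℝ hk hK
  obtain ⟨g, -, ψ, hψ, hg⟩ :=
    (isCompact_closedBall (0 : EuclideanSpace ℝ (Fin n)) (K : ℝ)).tendsto_subseq'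
      hbound.frequently
  have hgmem : g ∈ clarkeGradient V x₀ :=
    mem_clarkeGradient_of_tendsto (fun i => hdiff (φ (ψ i))) (hylim.comp hψ.tendsto_atTop) hg
  have hflim : Tendsto (fun i => f (x (φ (ψ i)))) atTop (𝓝 (f x₀)) :=
    (hf x₀ hx₀).tendsto.comp (tendsto_nhdsWithin_iff.2
      ⟨hlim.comp hψ.tendsto_atTop, Eventually.of_forall fun i => hxS _⟩)
  -- `-0` is the limit of the lower bounds `-(1 / (φ k + 1))`.
  have hle : -0 ≤ inner ℝ g (f x₀) :=
    le_of_tendsto_of_tendsto' (hsmall.comp hψ.tendsto_atTop).neg (hg.inner hflim)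
      fun i => (hinner (φ (ψ i))).le
  exact absurd (hneg x₀ hx₀ g hgmem) (by linarith)

end Clarke

/-! ### Deterministic convergence of the perturbed Euler scheme. -/

section Perturbed

variable {n : ℕ}

/-- Convergence of a perturbed Euler scheme `y (k + 1) = y k + a k • f (u k)`, `y k - u k → 0`, for
a vector field with a strict nonsmooth Lyapunov function on a compact set. -/
theorem tendsto_of_strict_clarke_lyapunov {V : EuclideanSpace ℝ (Fin n) → ℝ}
    (hV : LocallyLipschitz V) {S : Set (EuclideanSpace ℝ (Fin n))} (hS : IsCompact S)
    {f : EuclideanSpace ℝ (Fin n) → EuclideanSpace ℝ (Fin n)} (hf : ContinuousOn f S)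
    {xs : EuclideanSpace ℝ (Fin n)} (hmin : ∀ x ∈ S, x ≠ xs → V xs < V x)
    (hneg : ∀ x ∈ S, x ≠ xs → ∀ g ∈ clarkeGradient V x, inner ℝ g (f x) < 0)
    {a : ℕ → ℝ} (ha : ∀ k, 0 ≤ a k) (ha0 : Tendsto a atTop (𝓝 0)) (hasum : ¬ Summable a)
    {u y : ℕ → EuclideanSpace ℝ (Fin n)} (hu : ∀ k, u k ∈ S)
    (hy : ∀ k, y (k + 1) = y k + a k • f (u k))
    (huy : Tendsto (fun k => y k - u k) atTop (𝓝 0)) :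
    Tendsto u atTop (𝓝 xs) := by
  have hVc := hV.continuous
  have hstep : Tendsto (fun k => a k • f (u k)) atTop (𝓝 0) := by
    obtain ⟨M, hM⟩ := hS.exists_bound_of_continuousOn hf
    refine squeeze_zero_norm (a := fun k => a k * M) (fun k => ?_) (by simpa using ha0.mul_const M)
    rw [norm_smul, Real.norm_of_nonneg (ha k)]
    exact mul_le_mul_of_nonneg_left (hM _ (hu k)) (ha k)
  have huy' : Tendsto (fun k => y (k + 1) - u k) atTop (𝓝 0) := by
    have := huy.add hstep
    rw [add_zero] at this
    refine this.congr fun k => ?_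
    rw [hy]; abel
  have key : ∀ l, V xs < l → ∀ᶠ k in atTop, V (y k) < l := by
    intro l hl
    -- `V < l` on the `δ`-ball, but cases split at `δ / 2`: the other half absorbs the gap between
    -- `u k` and `y (k + 1)`.
    obtain ⟨δ, hδ, hVδ⟩ := Metric.eventually_nhds_iff_ball.1
      (hVc.continuousAt.eventually (gt_mem_nhds hl))
    obtain ⟨η, hη, ε, hε, hgrad⟩ := exists_forall_inner_gradient_le hV
      (hS.diff (Metric.isOpen_ball (x := xs) (ε := δ / 2))) (hf.mono Set.sdiff_subset)
      (fun x hx => hneg x hx.1 (by rintro rfl; exact hx.2 (Metric.mem_ball_self (by positivity))))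
    obtain ⟨N, hN⟩ : ∃ N, ∀ k ≥ N, ‖y k - u k‖ < ε ∧ ‖y (k + 1) - u k‖ < min ε (δ / 2) := by
      refine eventually_atTop.1 (Eventually.and ?_ ?_)
      · exact huy.norm.eventually (gt_mem_nhds (by simpa using hε))
      · exact huy'.norm.eventually (gt_mem_nhds (by simp; constructor <;> positivity))
    have hnear : ∀ k ≥ N, u k ∈ Metric.ball xs (δ / 2) → V (y (k + 1)) < l := by
      intro k hk hball
      refine hVδ _ ?_
      have h1 := (lt_min_iff.1 (hN k hk).2).2
      rw [← dist_eq_norm] at h1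
      have h2 := dist_triangle (y (k + 1)) (u k) xs
      rw [Metric.mem_ball] at hball ⊢
      linarith
    have hfar : ∀ k ≥ N, u k ∉ Metric.ball xs (δ / 2) →
        V (y (k + 1)) ≤ V (y k) + a k * -η := by
      intro k hk hball
      have h1 : y k ∈ Metric.ball (u k) ε := by simpa [dist_eq_norm] using (hN k hk).1
      have h2 : y (k + 1) ∈ Metric.ball (u k) ε := by
        simpa [dist_eq_norm] using (lt_min_iff.1 (hN k hk).2).1
      rw [hy] at h2 ⊢
      refine hV.le_add_of_fderiv_le h1 h2 fun z hz hd => ?_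
      have h3 := hgrad (u k) ⟨hu k, hball⟩ z hz hd
      have h4 : inner ℝ (gradient V z) (f (u k)) = fderiv ℝ V z (f (u k)) := by
        rw [gradient, InnerProductSpace.toDual_symm_apply]
      rw [map_smul, smul_eq_mul, ← h4]
      exact mul_le_mul_of_nonneg_left h3 (ha k)
    -- Otherwise `u k` never enters the inner ball, and the divergent sum of steps drives `V (y k)`
    -- below `l`.
    have hex : ∃ k ≥ N, V (y k) < l := by
      by_contra! hcon
      have hdec : ∀ j, V (y (j + N)) ≤ V (y N) - η * ∑ i ∈ Finset.range j, a (i + N) := by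
        intro j
        induction j with
        | zero => simp
        | succ j ih =>
          have hk : N ≤ j + N := Nat.le_add_left _ _
          have h1 := hfar (j + N) hk fun hb =>
            absurd (hnear _ hk hb) (not_lt.2 (hcon _ (hk.trans (Nat.le_succ _))))
          rw [Finset.sum_range_succ, show j + 1 + N = j + N + 1 by omega]
          linarith
      have hdiv : Tendsto (fun j => ∑ i ∈ Finset.range j, a (i + N)) atTop atTop :=
        (not_summable_iff_tendsto_nat_atTop_of_nonneg fun i => ha _).1
          (mt (summable_nat_add_iff N).1 hasum)
      obtain ⟨j, hj⟩ := (hdiv.eventually_gt_atTop ((V (y N) - l) / η)).exists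
      rw [div_lt_iff₀ hη] at hj
      have := hdec j
      have := hcon (j + N) (Nat.le_add_left _ _)
      linarith
    obtain ⟨k₀, hk₀, hlt⟩ := hex
    refine eventually_atTop.2 ⟨k₀, fun k hk => ?_⟩
    induction k, hk using Nat.le_induction with
    | base => exact hlt
    | succ k hk ih =>
      by_cases hb : u k ∈ Metric.ball xs (δ / 2)
      · exact hnear k (hk₀.trans hk) hb
      · have := hfar k (hk₀.trans hk) hb
        have := mul_nonneg (ha k) hη.le
        linarith
  refine tendsto_of_subseq_tendsto fun ns hns => ?_
  obtain ⟨z, hz, φ, hφ, hlim⟩ := hS.tendsto_subseq fun k => hu (ns k)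
  have hsub : Tendsto (fun k => ns (φ k)) atTop atTop := hns.comp hφ.tendsto_atTop
  have hylim : Tendsto (fun k => y (ns (φ k))) atTop (𝓝 z) := by
    simpa using (huy.comp hsub).add hlim
  have hle : V z ≤ V xs := le_of_forall_gt_imp_ge_of_dense fun l hl =>
    le_of_tendsto ((hVc.tendsto z).comp hylim) ((hsub.eventually (key l hl)).mono fun _ h => h.le)
  have hzx : z = xs := by
    by_contra h
    exact absurd (hmin z hz h) (not_lt.2 hle)
  exact ⟨φ, hzx ▸ hlim⟩

end Perturbed

/-! ### Almost sure convergence of the noise series. -/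

section Noise

variable {Ω : Type*} {m0 : MeasurableSpace Ω} {P : Measure Ω} [IsProbabilityMeasure P]

/-- A series of real martingale differences with summable second moments converges almost
surely. -/
theorem ae_exists_tendsto_sum_of_martingale_difference (ℱ : Filtration ℕ m0) {d : ℕ → Ω → ℝ}
    (hadp : ∀ k, StronglyMeasurable[ℱ (k + 1)] (d k)) (hd : ∀ k, MemLp (d k) 2 P)
    (hcond : ∀ k, P[d k | ℱ k] =ᵐ[P] 0) {b : ℕ → ℝ} (hb : Summable b)
    (hdb : ∀ k, ∫ ω, d k ω ^ 2 ∂P ≤ b k) :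
    ∀ᵐ ω ∂P, ∃ l, Tendsto (fun k => ∑ j ∈ Finset.range k, d j ω) atTop (𝓝 l) := by
  set M : ℕ → Ω → ℝ := fun k ω => ∑ j ∈ Finset.range k, d j ω with hM
  have hMsucc : ∀ k, M (k + 1) = M k + d k := fun k => by
    ext ω; simp [hM, Finset.sum_range_succ]
  have hMadp : StronglyAdapted ℱ M := fun k =>
    Finset.stronglyMeasurable_fun_sum _ fun j hj =>
      (hadp j).mono (ℱ.mono (Nat.succ_le_of_lt (Finset.mem_range.1 hj)))
  have hM2 : ∀ k, MemLp (M k) 2 P := fun k => memLp_finsetSum _ fun j _ => hd j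
  have hMint : ∀ k, Integrable (M k) P := fun k => (hM2 k).integrable one_le_two
  have hmart : Martingale M ℱ P := martingale_of_condExp_sub_eq_zero_nat hMadp hMint fun k => by
    rw [hMsucc, add_sub_cancel_left]; exact hcond k
  have horth : ∀ k, ∫ ω, M k ω * d k ω ∂P = 0 := fun k => by
    have hint : Integrable (M k * d k) P := (hM2 k).integrable_mul (hd k)
    have h := condExp_mul_of_stronglyMeasurable_left (hMadp k) hint
      ((hd k).integrable one_le_two)
    have h0 : P[M k * d k | ℱ k] =ᵐ[P] 0 := by
      filter_upwards [h, hcond k] with ω h1 h2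
      simp [h1, h2]
    have := integral_condExp (μ := P) (f := M k * d k) (ℱ.le k)
    rw [integral_congr_ae h0] at this
    simpa using this.symm
  have hsq : ∀ k, ∫ ω, M k ω ^ 2 ∂P ≤ ∑ j ∈ Finset.range k, b j := fun k => by
    induction k with
    | zero => simp [hM]
    | succ k ih =>
      have h1 := (hM2 k).integrable_sq
      have h2 := (hd k).integrable_sq
      have h3 : Integrable (fun ω => 2 * (M k ω * d k ω)) P :=
        ((hM2 k).integrable_mul (hd k)).const_mul 2
      have : ∫ ω, M (k + 1) ω ^ 2 ∂P = ∫ ω, (M k ω ^ 2 + 2 * (M k ω * d k ω) + d k ω ^ 2) ∂P := by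
        congr 1; ext ω; rw [hMsucc, Pi.add_apply]; ring
      rw [this, integral_add (h1.fun_add h3) h2, integral_add h1 h3, integral_const_mul, horth,
        Finset.sum_range_succ]
      linarith [hdb k]
  have hbnn : ∀ k, 0 ≤ b k := fun k => (integral_nonneg fun ω => sq_nonneg _).trans (hdb k)
  -- The L¹ bound comes from the L² bound through `|M| ≤ 1 + M ^ 2`.
  refine hmart.submartingale.exists_ae_tendsto_of_bdd (R := (1 + ∑' j, b j).toNNReal) fun k => ?_
  rw [eLpNorm_one_eq_lintegral_enorm, ← ofReal_integral_norm_eq_lintegral_enorm (hMint k)]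
  refine ENNReal.ofReal_le_ofReal ?_
  calc ∫ ω, ‖M k ω‖ ∂P ≤ ∫ ω, (1 + M k ω ^ 2) ∂P :=
        integral_mono (hMint k).norm ((integrable_const _).add (hM2 k).integrable_sq) fun ω => by
          rw [Real.norm_eq_abs, ← sq_abs]
          nlinarith [sq_nonneg (|M k ω| - 1), abs_nonneg (M k ω)]
    _ = 1 + ∫ ω, M k ω ^ 2 ∂P := by
        rw [integral_add (integrable_const _) (hM2 k).integrable_sq]; simp
    _ ≤ _ := by
        gcongr
        exact (hsq k).trans (hb.sum_le_tsum _ fun j _ => hbnn j)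

theorem measurable_history_left {E : Type*} [MeasurableSpace E] (x w : ℕ → Ω → E) {j k : ℕ}
    (h : j < k) : Measurable[history x w k] (w j) := by
  refine Measurable.of_comap_le (le_sup_of_le_right ?_)
  exact le_iSup₂_of_le j h le_rfl

/-- The filtration of histories of two measurable processes. -/
def historyFiltration {E : Type*} [MeasurableSpace E] {x w : ℕ → Ω → E}
    (hx : ∀ k, Measurable (x k)) (hw : ∀ k, Measurable (w k)) : Filtration ℕ m0 where
  seq := history x w
  mono' _ _ hij := sup_le_sup
    (iSup₂_le fun l hl => le_iSup₂_of_le l (hl.trans hij) le_rfl)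
    (iSup₂_le fun l hl => le_iSup₂_of_le l (hl.trans_le hij) le_rfl)
  le' _ := sup_le (iSup₂_le fun j _ => (hx j).comap_le) (iSup₂_le fun j _ => (hw j).comap_le)

/-- The weighted noise series converges almost surely. -/
theorem NoiseAssumption.ae_exists_tendsto_sum {n : ℕ}
    {x w : ℕ → Ω → EuclideanSpace ℝ (Fin n)} {A B r : ℝ} (hw : NoiseAssumption P x w A B)
    (hx : ∀ k, Measurable (x k)) (hbdd : ∀ k, ∀ᵐ ω ∂P, ‖x k ω‖ ≤ r) {a : ℕ → ℝ}
    (ha : Summable fun k => a k ^ 2) :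
    ∀ᵐ ω ∂P, ∃ l, Tendsto (fun k => ∑ j ∈ Finset.range k, a j • w j ω) atTop (𝓝 l) := by
  let ℱ := historyFiltration hx hw.measurable
  -- Absolute values, because `A` and `B` carry no sign assumption.
  have hbound : ∀ k, ∫ ω, ‖w k ω‖ ^ 2 ∂P ≤ |A| + |B| * r ^ 2 := fun k => by
    rw [← integral_condExp (ℱ.le k)]
    have h : P[fun ω => ‖w k ω‖ ^ 2 | ℱ k] ≤ᵐ[P] fun _ => |A| + |B| * r ^ 2 := by
      filter_upwards [hw.second_moment k, hbdd k] with ω h1 h2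
      refine h1.trans (add_le_add (le_abs_self A) ?_)
      exact mul_le_mul (le_abs_self B) (by gcongr) (by positivity) (abs_nonneg B)
    simpa using integral_mono_ae integrable_condExp (integrable_const _) h
  have hcoord : ∀ i : Fin n, ∀ᵐ ω ∂P, ∃ l,
      Tendsto (fun k => ∑ j ∈ Finset.range k, a j * w j ω i) atTop (𝓝 l) := by
    intro i
    have hL : ∀ k, MemLp (fun ω => w k ω i) 2 P := fun k =>
      (hw.memLp k).continuousLinearMap_comp (EuclideanSpace.proj (𝕜 := ℝ) i)
    refine ae_exists_tendsto_sum_of_martingale_difference ℱ (d := fun k ω => a k * w k ω i)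
      (fun k => ?_) (fun k => (hL k).const_mul (a k)) (fun k => ?_)
      (ha.mul_right (|A| + |B| * r ^ 2)) (fun k => ?_)
    · have h1 : Measurable[ℱ (k + 1)] (w k) := measurable_history_left x w (Nat.lt_succ_self k)
      have h2 : Measurable[ℱ (k + 1)] (fun ω => w k ω i) :=
        (EuclideanSpace.proj (𝕜 := ℝ) i).continuous.measurable.comp h1
      exact (h2.const_mul (a k)).stronglyMeasurable
    · have h1 := (EuclideanSpace.proj (𝕜 := ℝ) i).comp_condExp_comm (m := ℱ k)
        ((hw.memLp k).integrable one_le_two)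
      have h2 := condExp_smul (μ := P) (a k) (fun ω => w k ω i) (ℱ k)
      filter_upwards [h1, h2, hw.unbiased k] with ω h1 h2 h3
      refine h2.trans ?_
      have h4 : (P[fun ω => w k ω i | ℱ k]) ω = 0 := by
        refine h1.symm.trans ?_
        simp only [Function.comp_apply]
        erw [h3]
        simp
      simp [h4]
    · simp_rw [mul_pow]
      rw [integral_const_mul]
      refine mul_le_mul_of_nonneg_left (le_trans ?_ (hbound k)) (sq_nonneg _)
      refine integral_mono (hL k).integrable_sq (hw.memLp k).integrable_norm_pow' fun ω => ?_
      have := PiLp.norm_apply_le (w k ω) i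
      rw [Real.norm_eq_abs] at this
      simpa using sq_le_sq' (by linarith [abs_nonneg (w k ω i), neg_abs_le (w k ω i)])
        ((le_abs_self _).trans this)
  filter_upwards [ae_all_iff.2 hcoord] with ω h
  choose l hl using h
  refine ⟨WithLp.toLp 2 l, ?_⟩
  have h1 : Tendsto (fun k => (fun i => ∑ j ∈ Finset.range k, a j * w j ω i)) atTop (𝓝 l) :=
    tendsto_pi_nhds.2 hl
  refine (((PiLp.continuous_toLp 2 fun _ : Fin n => ℝ).tendsto l).comp h1).congr fun k => ?_
  ext i
  simp

end Noise

/-- `t ↦ 3t / (3t - 1)` is at most `3/2` for `t ≥ 1`. This forces `ξ ≤ 1`, hence non-summable steps.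
-/
theorem rateExponent_le {a c : ℝ} (ha : 0 < a) (hc : 1 ≤ c) : 2 * rateExponent a c / 3 ≤ 1 := by
  have hD : 1 ≤ driftExponent a c := by
    have := mul_nonneg ha.le (sub_nonneg.2 hc)
    unfold driftExponent
    linarith
  have h : rateExponent a c ≤ 3 / 2 := by
    rw [rateExponent, div_le_div_iff₀ (by linarith) (by norm_num)]
    linarith
  linarith

/-! ### Summability of the step sizes. -/

section StepSize

variable {α K ξ : ℝ}

theorem summable_div_nat_add_rpow_iff (hα : 0 < α) (hK : 0 < K) :
    Summable (fun k : ℕ => α / ((k : ℝ) + K) ^ ξ) ↔ 1 < ξ := by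
  rw [← Real.summable_one_div_nat_add_rpow K ξ,
    ← summable_mul_left_iff (f := fun k : ℕ => 1 / |(k : ℝ) + K| ^ ξ) hα.ne']
  refine summable_congr fun k => ?_
  rw [abs_of_pos (by positivity)]
  ring

theorem summable_sq_div_nat_add_rpow (hK : 0 < K) (hξ : 1 < 2 * ξ) :
    Summable (fun k : ℕ => (α / ((k : ℝ) + K) ^ ξ) ^ 2) := by
  refine (((Real.summable_one_div_nat_add_rpow K (2 * ξ)).2 hξ).mul_left (α ^ 2)).congr
    fun k => ?_
  have hk : 0 < (k : ℝ) + K := by positivity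
  rw [abs_of_pos hk, div_pow, mul_comm 2 ξ, Real.rpow_mul hk.le, Real.rpow_two]
  ring

theorem tendsto_div_nat_add_rpow (hξ : 0 < ξ) :
    Tendsto (fun k : ℕ => α / ((k : ℝ) + K) ^ ξ) atTop (𝓝 0) :=
  tendsto_const_nhds.div_atTop ((tendsto_rpow_atTop hξ).comp
    (tendsto_atTop_add_const_right _ _ tendsto_natCast_atTop_atTop))

end StepSize

theorem mainTheorem6 {Ω : Type*} [MeasurableSpace Ω] (P : Measure Ω) [IsProbabilityMeasure P]
    (n m : ℕ)
    (F : EuclideanSpace ℝ (Fin n) → EuclideanSpace ℝ (Fin m) → EuclideanSpace ℝ (Fin n))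
    (ρ : EuclideanSpace ℝ (Fin n) → EuclideanSpace ℝ (Fin m))
    (V : EuclideanSpace ℝ (Fin n) → ℝ) (xs : EuclideanSpace ℝ (Fin n))
    (x w : ℕ → Ω → EuclideanSpace ℝ (Fin n))
    (a c C₁ C₂ G γ C A B r α K ξ : ℝ)
    (ha : 0 < a) (hc : 1 ≤ c) (hC₁ : 0 < C₁) (hC₂ : 0 < C₂) (hγ : 0 < γ)
    (hα : 0 < α) (hK : 0 < K)
    (hξ : ξ ∈ Set.Ioc (2 / 3) (2 * rateExponent a c / 3))
    (hxs : F xs (ρ xs) = 0) (hxsr : ‖xs‖ ≤ r)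
    (hF : ∀ y ∈ Metric.closedBall (0 : EuclideanSpace ℝ (Fin n)) r,
      ∀ z ∈ Metric.closedBall (0 : EuclideanSpace ℝ (Fin n)) r,
        ‖F y (ρ y) - F z (ρ z)‖ ≤ C * ‖y - z‖)
    (hV : LyapunovAssumption V (fun y => F y (ρ y)) xs (Metric.closedBall 0 r) a c C₁ C₂ G γ)
    (hxm : ∀ k, Measurable (x k))
    (hw : NoiseAssumption P x w A B)
    (hx : ∀ k, ∀ᵐ ω ∂P,
      x (k + 1) ω = x k ω + (α / ((k : ℝ) + K) ^ ξ) • (F (x k ω) (ρ (x k ω)) + w k ω))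
    (hbdd : ∀ k, ∀ᵐ ω ∂P, ‖x k ω‖ ≤ r) :
    ∀ᵐ ω ∂P,
      Tendsto (fun k => Metric.infDist (x k ω) {y | F y (ρ y) = 0}) atTop (𝓝 0) ∧
        Tendsto (fun k => x k ω) atTop (𝓝 xs) := by
  have hξ1 : ξ ≤ 1 := hξ.2.trans (rateExponent_le ha hc)
  have hξ0 : 2 / 3 < ξ := hξ.1
  set S := Metric.closedBall (0 : EuclideanSpace ℝ (Fin n)) r
  set f : EuclideanSpace ℝ (Fin n) → EuclideanSpace ℝ (Fin n) := fun y => F y (ρ y)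
  set s : ℕ → ℝ := fun k => α / ((k : ℝ) + K) ^ ξ
  have hspos : ∀ k, 0 ≤ s k := fun k => by positivity
  have hxsS : xs ∈ S := by simpa [S] using hxsr
  have hfc : ContinuousOn f S :=
    (LipschitzOnWith.of_dist_le_mul (K := C.toNNReal) fun y hy z hz => by
      rw [dist_eq_norm, dist_eq_norm]
      exact (hF y hy z hz).trans
        (mul_le_mul_of_nonneg_right (Real.le_coe_toNNReal C) (norm_nonneg _))).continuousOn
  have hVxs : V xs ≤ 0 := by
    simpa [Real.zero_rpow ha.ne'] using hV.upper_growth xs hxsS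
  have hVpos : ∀ y ∈ S, y ≠ xs → 0 < V y := fun y hy hne =>
    (mul_pos hC₁ (Real.rpow_pos_of_pos (norm_pos_iff.2 (sub_ne_zero.2 hne)) a)).trans_le
      (hV.lower_growth y hy)
  have hneg : ∀ y ∈ S, y ≠ xs → ∀ g ∈ clarkeGradient V y, inner ℝ g (f y) < 0 :=
    fun y hy hne g hg => (hV.drift y hy g hg).trans_lt (by
      have := mul_pos hγ (Real.rpow_pos_of_pos (hVpos y hy hne) c)
      linarith)
  have hnoise := hw.ae_exists_tendsto_sum hxm hbdd
    (summable_sq_div_nat_add_rpow (α := α) hK (by linarith : 1 < 2 * ξ))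
  filter_upwards [hnoise, ae_all_iff.2 hx, ae_all_iff.2 hbdd] with ω ⟨l, hl⟩ hxω hbω
  have hmain : Tendsto (fun k => x k ω) atTop (𝓝 xs) := by
    refine tendsto_of_strict_clarke_lyapunov hV.locallyLipschitz (isCompact_closedBall 0 r) hfc
      (fun y hy hne => hVxs.trans_lt (hVpos y hy hne)) hneg hspos
      (tendsto_div_nat_add_rpow (by linarith))
      (mt (summable_div_nat_add_rpow_iff hα hK).1 (not_lt.2 hξ1))
      -- Adding the noise still to come cancels `w k` from the recursion.
      (y := fun k => x k ω + (l - ∑ j ∈ Finset.range k, s j • w j ω))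
      (fun k => by simpa using hbω k) (fun k => ?_) ?_
    · rw [hxω k, Finset.sum_range_succ, smul_add]
      abel
    · simpa using (tendsto_const_nhds (x := l)).sub hl
  refine ⟨?_, hmain⟩
  refine squeeze_zero (fun _ => Metric.infDist_nonneg)
    (fun k => Metric.infDist_le_dist_of_mem (show xs ∈ {y | F y (ρ y) = 0} from hxs)) ?_
  exact tendsto_iff_dist_tendsto_zero.1 hmain
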